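/- **Setting.** Let $[B]=\{1,\dots,B\}$. For a dataset $X=(x_1,\dots,x_n)\in[B]^n$, $n\ge 1$, put $F_X(m)=\frac1n|\{j: x_j\le m\}|$ for integers $m\ge 0$. A value $m\in\{0,1,\dots,B\}$ is an *$\alpha$-approximate $q$-quantile* of $X$ if $[F_X(m),F_X(m+1)]\cap(q-\alpha,q+\alpha)\ne\emptyset$ (an *$\alpha$-approximate median* if $q=\tfrac12$). A *sequentially adaptive protocol* with $n$ users, user $j$ holding $x_j$, has $n$ rounds; in each round the aggregator selects a user who has not been queried before, and this user sends the output of a randomized mechanism applied to their data point. The selected user and the mechanism may depend on the aggregator's (public) randomness and on all earlier messages. After the last round the aggregator outputs a value $\tilde m\in\{0,\dots,B\}$ depending on its randomness and all messages. The protocol is *$\varepsilon$-LDP* if, for every fixed value of the randomness and the earlier messages, the mechanism $\mathcal M$ used satisfies $\Pr[\mathcal M(x)\in S]\le e^{\varepsilon}\Pr[\mathcal M(x')\in S]$ for all $x,x'\in[B]$ and all measurable $S$. It *solves empirical $q$-quantile estimation with accuracy $\alpha$ and probability $p$* if for every $X\in[B]^n$ the output is an $\alpha$-approximate $q$-quantile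 of $X$ with probability at least $p$. **Theorem.** There is a universal constant $c>0$ such that the following hold. 1. There is $B_0$ such that for all $B\ge B_0$, $0<\alpha\le\frac12$, $0<\varepsilon<1$, all $q$ with $q=\frac12$ or $q\in(2\alpha,1-2\alpha)$, and all $n\ge1$: if some sequentially adaptive $\varepsilon$-LDP protocol with $n$ users solves empirical $q$-quantile estimation with accuracy $\alpha$ and probability $\frac34$, then $$n\ \ge\ c\,\frac{\log B}{\varepsilon^2\alpha^2}.$$ In particular, if such protocols exist for all dataset sizes $n\ge n_0$, where $n_0\ge 1$, then $n_0\ge c\,\frac{\log B}{\varepsilon^2\alpha^2}$. 2. The same lower bound on $n$ holds for all $B\ge4$, $0<\alpha<\frac12$, $q\in(2\alpha,1-2\alpha)$ and $0<\varepsilon\le\min\{1,\frac1{64}\sqrt{\log B}\}$. -/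

import Mathlib

open MeasureTheory ProbabilityTheory

universe u

noncomputable section

/-- What the aggregator knows before round `i` (rounds are numbered `0, 1, 2, …`): its own random
seed, followed by the messages `y₀, …, y_{i-1}` received so far. -/
def Hist (Seed : Type u) (Msg : ℕ → Type u) : ℕ → Type u
  | 0 => Seed
  | i + 1 => Hist Seed Msg i × Msg i

instance Hist.instMeasurableSpace (Seed : Type u) (Msg : ℕ → Type u) [MeasurableSpace Seed]
    [∀ i, MeasurableSpace (Msg i)] : ∀ i, MeasurableSpace (Hist Seed Msg i)
  | 0 => inferInstanceAs (MeasurableSpace Seed)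
  | i + 1 =>
    letI := Hist.instMeasurableSpace Seed Msg i
    inferInstanceAs (MeasurableSpace (Hist Seed Msg i × Msg i))

/-- The users queried in rounds `0, …, i-1` along a history, when `user i h` is the user queried in
round `i` after the history `h`. -/
def queried {Seed : Type u} {Msg : ℕ → Type u} {n : ℕ}
    (user : ∀ i, Hist Seed Msg i → Fin n) : ∀ i, Hist Seed Msg i → Finset (Fin n)
  | 0, _ => ∅
  | i + 1, h => insert (user i h.1) (queried user i h.1)

/-- A sequentially adaptive protocol for `n` users with data in `[B] = {1, …, B}`; the element `k` of
`Fin B` stands for `k + 1`. There are `n` rounds, and each of them queries one user who has not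
been queried before. The user to be queried and the mechanism which that user runs may depend on the
aggregator's random seed and on all earlier messages. After round `n - 1` the aggregator outputs a
value in `{0, 1, …, B}`. (Only the rounds `i < n` matter.) -/
structure SeqProtocol (B n : ℕ) where
  /-- the aggregator's randomness, which is also known to the users -/
  Seed : Type u
  [measSeed : MeasurableSpace Seed]
  seedLaw : Measure Seed
  [probSeed : IsProbabilityMeasure seedLaw]
  /-- the space of messages of round `i` -/
  Msg : ℕ → Type u
  [measMsg : ∀ i, MeasurableSpace (Msg i)]
  /-- the user queried in round `i` -/
  user : ∀ i, Hist Seed Msg i → Fin n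
  measurable_user : ∀ i, Measurable (user i)
  user_notMem : ∀ i < n, ∀ h, user i h ∉ queried user i h
  /-- `mech i (h, x)` is the law of the message sent in round `i` after the history `h` by a user
  with data point `x` -/
  mech : ∀ i, Kernel (Hist Seed Msg i × Fin B) (Msg i)
  [markov_mech : ∀ i, IsMarkovKernel (mech i)]
  /-- the post-processing function of the aggregator -/
  estimate : Hist Seed Msg n → Fin (B + 1)
  measurable_estimate : Measurable estimate

attribute [instance] SeqProtocol.measSeed SeqProtocol.probSeed SeqProtocol.measMsg
  SeqProtocol.markov_mech

namespace SeqProtocol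

variable {B n : ℕ} (P : SeqProtocol.{u} B n)

/-- The law of the message of round `i` given the history, when user `j` holds `x j`. -/
def step (x : Fin n → Fin B) (i : ℕ) : Kernel (Hist P.Seed P.Msg i) (P.Msg i) :=
  (P.mech i).comap (fun h => (h, x (P.user i h)))
    (measurable_id.prodMk ((measurable_of_finite x).comp (P.measurable_user i)))

/-- The law of the history after `i` rounds on the dataset `x`. -/
def law (x : Fin n → Fin B) : ∀ i, Measure (Hist P.Seed P.Msg i)
  | 0 => P.seedLaw
  | i + 1 => law x i ⊗ₘ P.step x i

/-- Every mechanism used is `ε`-locally differentially private in the data point of the user, for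
each fixed value of the history. -/
def IsLDP (ε : ℝ) : Prop :=
  ∀ i < n, ∀ (h : Hist P.Seed P.Msg i) (x x' : Fin B) (S : Set (P.Msg i)), MeasurableSet S →
    P.mech i (h, x) S ≤ ENNReal.ofReal (Real.exp ε) * P.mech i (h, x') S

end SeqProtocol

/-- The empirical distribution function `F_X(m)` of a dataset, the fraction of the data points that
are at most `m`. -/
def ecdf {B n : ℕ} (x : Fin n → Fin B) (m : ℕ) : ℝ :=
  ((Finset.univ.filter fun j => (x j : ℕ) + 1 ≤ m).card : ℝ) / n

/-- `m` is an `α`-approximate `q`-quantile of the dataset `x`. -/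
def IsApproxQuantile {B n : ℕ} (q α : ℝ) (x : Fin n → Fin B) (m : ℕ) : Prop :=
  (Set.Icc (ecdf x m) (ecdf x (m + 1)) ∩ Set.Ioo (q - α) (q + α)).Nonempty

/-- On every dataset, the protocol outputs an `α`-approximate empirical `q`-quantile with probability
at least `p`. -/
def SeqProtocol.SolvesEmpQuantile {B n : ℕ} (P : SeqProtocol.{u} B n) (α q p : ℝ) : Prop :=
  ∀ x : Fin n → Fin B, p ≤ (P.law x n).real {h | IsApproxQuantile q α x (P.estimate h : ℕ)}

end

/-! The proof hides one of `B` values by a small perturbation of a fixed dataset. In the base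
dataset every user holds one of the two extreme values. Independently, user `j` switches to a hidden
value `v` with probability `β j`, of order `α` on a set of at least half the users. With probability
at least `19/20` so many switch that `v` alone carries the quantile, and the output must reveal `v`.

A private message has chi-square divergence at most `exp ε + exp (-ε) - 2 ≤ 2 ε²` between two data
points, so switching with probability `β` costs a factor `1 + 2 ε² β²` in second moment. Each user
speaks once, so these factors multiply even under adaptive querying. With `Q` the law of the history
on the base dataset and `M_v` the mixture for `v`, this gives `M_v(A)² ≤ exp (2 ε² ∑ β²) Q(A)`
(`sq_sum_law_le`). The events "output `v`" are disjoint, so their `Q`-probabilities sum to at most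
one. Summing over `v` gives `B s² ≤ exp (2 ε² ∑ β²)` for a success probability `s`
(`card_mul_sq_le`), where `∑ β²` is of order `α² n` (`exists_switching_probabilities`). -/

open scoped ENNReal

/-! ### Chi-square bounds for a single private message -/

section OneStep

variable {Y : Type*} [MeasurableSpace Y]

/-- The Cauchy–Schwarz inequality for the Lebesgue integral. -/
theorem sq_lintegral_mul_le (μ : Measure Y) {f g : Y → ℝ≥0∞} (hf : Measurable f)
    (hg : Measurable g) :
    (∫⁻ y, f y * g y ∂μ) ^ 2 ≤ (∫⁻ y, f y ^ 2 ∂μ) * ∫⁻ y, g y ^ 2 ∂μ := by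
  have h := ENNReal.lintegral_mul_le_Lp_mul_Lq μ (p := 2) (q := 2)
    Real.HolderConjugate.two_two hf.aemeasurable hg.aemeasurable
  have h2 := pow_le_pow_left' h 2
  simp only [Pi.mul_apply] at h2
  refine h2.trans_eq ?_
  rw [mul_pow, ← ENNReal.rpow_natCast, ← ENNReal.rpow_natCast, ← ENNReal.rpow_mul,
    ← ENNReal.rpow_mul]
  norm_num

/-- If two probability measures are within a factor `exp ε` of each other, then the chi-square
divergence between them is at most `exp ε + exp (-ε) - 2`. -/
theorem lintegral_rnDeriv_sq_le {μ₀ μ₁ : Measure Y} [IsProbabilityMeasure μ₀]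
    [IsProbabilityMeasure μ₁] {ε : ℝ}
    (h₁₀ : ∀ S, MeasurableSet S → μ₁ S ≤ ENNReal.ofReal (Real.exp ε) * μ₀ S)
    (h₀₁ : ∀ S, MeasurableSet S → μ₀ S ≤ ENNReal.ofReal (Real.exp ε) * μ₁ S) :
    ∫⁻ y, μ₁.rnDeriv μ₀ y ^ 2 ∂μ₀
      ≤ 1 + ENNReal.ofReal (Real.exp ε + Real.exp (-ε) - 2) := by
  have hac : μ₁ ≪ μ₀ := Measure.AbsolutelyContinuous.mk fun S hS h0 => by
    simpa [h0] using h₁₀ S hS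
  set r := μ₁.rnDeriv μ₀ with hr
  have hrm : Measurable r := Measure.measurable_rnDeriv _ _
  have hset : ∀ S, ∫⁻ y in S, r y ∂μ₀ = μ₁ S := fun S => Measure.setLIntegral_rnDeriv hac S
  have hup : ∀ᵐ y ∂μ₀, r y ≤ ENNReal.ofReal (Real.exp ε) := by
    refine ae_le_of_forall_setLIntegral_le_of_sigmaFinite hrm fun S hS _ => ?_
    simpa [hset] using h₁₀ S hS
  have hlo : ∀ᵐ y ∂μ₀, 1 ≤ ENNReal.ofReal (Real.exp ε) * r y := by
    refine ae_le_of_forall_setLIntegral_le_of_sigmaFinite measurable_const fun S hS _ => ?_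
    rw [lintegral_const_mul _ hrm, hset]
    simpa using h₀₁ S hS
  -- This is `(r - exp ε) (r - exp (-ε)) ≤ 0`, valid as `r` lies between the two roots. Integrating
  -- with `∫ r = 1` gives the bound.
  have hpt : ∀ᵐ y ∂μ₀, r y ^ 2 + 1
      ≤ ENNReal.ofReal (Real.exp ε + Real.exp (-ε)) * r y := by
    filter_upwards [hup, hlo] with y h1 h2
    have hfin : r y ≠ ∞ := ne_top_of_le_ne_top ENNReal.ofReal_ne_top h1
    lift r y to NNReal using hfin with a
    have ha : (a : ℝ≥0∞) = ENNReal.ofReal (a : ℝ) := by simp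
    rw [ha] at h1 h2 ⊢
    have hE := Real.exp_pos ε
    rw [ENNReal.ofReal_le_ofReal_iff hE.le] at h1
    rw [← ENNReal.ofReal_mul hE.le, ENNReal.one_le_ofReal] at h2
    rw [← ENNReal.ofReal_mul (by positivity), ← ENNReal.ofReal_pow a.coe_nonneg, ← ENNReal.ofReal_one,
      ← ENNReal.ofReal_add (by positivity) zero_le_one]
    refine ENNReal.ofReal_le_ofReal ?_
    have hEE : Real.exp ε * Real.exp (-ε) = 1 := by rw [← Real.exp_add]; simp
    have hE' := Real.exp_pos (-ε)
    have h3 : Real.exp (-ε) ≤ a := by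
      nlinarith
    nlinarith
  have hint := lintegral_mono_ae hpt
  rw [lintegral_add_right _ measurable_const, lintegral_const_mul _ hrm,
    ← setLIntegral_univ r, hset] at hint
  simp only [lintegral_const, measure_univ, mul_one] at hint
  have h2 : (2 : ℝ) ≤ Real.exp ε + Real.exp (-ε) := by
    have hEE : Real.exp ε * Real.exp (-ε) = 1 := by rw [← Real.exp_add]; simp
    nlinarith [sq_nonneg (Real.exp ε - Real.exp (-ε)), Real.exp_pos ε, Real.exp_pos (-ε)]
  have hsplit : ENNReal.ofReal (Real.exp ε + Real.exp (-ε))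
      = 1 + ENNReal.ofReal (Real.exp ε + Real.exp (-ε) - 2) + 1 := by
    rw [← ENNReal.ofReal_one, ← ENNReal.ofReal_add (by norm_num) (by linarith),
      ← ENNReal.ofReal_add (by linarith) (by norm_num)]
    congr 1; ring
  rw [hsplit] at hint
  exact (ENNReal.add_le_add_iff_right ENNReal.one_ne_top).1 hint

/-- Second moment bound for a mixture of two measures that are within a factor `exp ε` of each
other. -/
theorem sq_lintegral_mixture_le {μ₀ μ₁ : Measure Y} [IsProbabilityMeasure μ₀]
    [IsProbabilityMeasure μ₁] {ε : ℝ}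
    (h₁₀ : ∀ S, MeasurableSet S → μ₁ S ≤ ENNReal.ofReal (Real.exp ε) * μ₀ S)
    (h₀₁ : ∀ S, MeasurableSet S → μ₀ S ≤ ENNReal.ofReal (Real.exp ε) * μ₁ S)
    {β γ : ℝ≥0∞} (hβγ : γ + β = 1) {f : Y → ℝ≥0∞} (hf : Measurable f) :
    (γ * ∫⁻ y, f y ∂μ₀ + β * ∫⁻ y, f y ∂μ₁) ^ 2
      ≤ (1 + β ^ 2 * ENNReal.ofReal (Real.exp ε + Real.exp (-ε) - 2)) * ∫⁻ y, f y ^ 2 ∂μ₀ := by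
  have hac : μ₁ ≪ μ₀ := Measure.AbsolutelyContinuous.mk fun S hS h0 => by
    simpa [h0] using h₁₀ S hS
  have hrm : Measurable (μ₁.rnDeriv μ₀) := Measure.measurable_rnDeriv _ _
  have hr1 : ∫⁻ y, μ₁.rnDeriv μ₀ y ∂μ₀ = 1 := by
    rw [Measure.lintegral_rnDeriv hac, measure_univ]
  have hr2 := lintegral_rnDeriv_sq_le h₁₀ h₀₁
  have hmix : γ * ∫⁻ y, f y ∂μ₀ + β * ∫⁻ y, f y ∂μ₁
      = ∫⁻ y, (γ + β * μ₁.rnDeriv μ₀ y) * f y ∂μ₀ := by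
    rw [← lintegral_rnDeriv_mul hac hf.aemeasurable, ← lintegral_const_mul _ hf,
      ← lintegral_const_mul β (f := fun y => μ₁.rnDeriv μ₀ y * f y) (hrm.mul hf),
      ← lintegral_add_left (hf.const_mul γ)]
    refine lintegral_congr fun y => ?_
    ring
  have hsq : ∫⁻ y, (γ + β * μ₁.rnDeriv μ₀ y) ^ 2 ∂μ₀
      ≤ 1 + β ^ 2 * ENNReal.ofReal (Real.exp ε + Real.exp (-ε) - 2) := by
    calc ∫⁻ y, (γ + β * μ₁.rnDeriv μ₀ y) ^ 2 ∂μ₀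
        = ∫⁻ y, γ ^ 2 + (2 * γ * β * μ₁.rnDeriv μ₀ y + β ^ 2 * μ₁.rnDeriv μ₀ y ^ 2) ∂μ₀ := by
          refine lintegral_congr fun y => ?_
          ring
      _ = γ ^ 2 + (2 * γ * β + β ^ 2 * ∫⁻ y, μ₁.rnDeriv μ₀ y ^ 2 ∂μ₀) := by
          rw [lintegral_add_left measurable_const, lintegral_add_left (hrm.const_mul _),
            lintegral_const_mul _ hrm, lintegral_const_mul _ (hrm.pow_const 2), hr1]
          simp
      _ ≤ γ ^ 2 + (2 * γ * β
            + β ^ 2 * (1 + ENNReal.ofReal (Real.exp ε + Real.exp (-ε) - 2))) := by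
          gcongr
      _ = (γ + β) ^ 2 + β ^ 2 * ENNReal.ofReal (Real.exp ε + Real.exp (-ε) - 2) := by ring
      _ = _ := by rw [hβγ, one_pow]
  rw [hmix]
  exact (sq_lintegral_mul_le μ₀ ((hrm.const_mul β).const_add γ) hf).trans
    (mul_le_mul_left hsq _)

end OneStep

/-! ### Independent bits -/

section ProductWeights

variable {ι R : Type*} [Fintype ι] [DecidableEq ι] [CommSemiring R]

/-- Product weights have total mass one. -/
theorem sum_prod_weight {p : ι → Bool → R} (hp : ∀ j, p j false + p j true = 1) :
    ∑ ω : ι → Bool, ∏ j, p j (ω j) = 1 := by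
  rw [← Fintype.piFinset_univ, ← Finset.prod_univ_sum]
  refine Finset.prod_eq_one fun j _ => ?_
  rw [Fintype.sum_bool, add_comm, hp]

/-- Exchangeability: swapping coordinate `u` with an independent copy of it preserves the joint
weight. -/
theorem prod_weight_update_mul (p : ι → Bool → R) (ω : ι → Bool) (u : ι) (a : Bool) :
    (∏ j, p j (Function.update ω u a j)) * p u (ω u) = (∏ j, p j (ω j)) * p u a := by
  rw [← Finset.mul_prod_erase _ _ (Finset.mem_univ u),
    ← Finset.mul_prod_erase _ (fun j => p j (ω j)) (Finset.mem_univ u)]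
  have : ∏ j ∈ Finset.univ.erase u, p j (Function.update ω u a j)
      = ∏ j ∈ Finset.univ.erase u, p j (ω j) :=
    Finset.prod_congr rfl fun j hj => by
      rw [Function.update_of_ne (Finset.ne_of_mem_erase hj)]
  rw [this, Function.update_self]
  ring

/-- Under product weights, the coordinate `u` is independent of a function of the others. -/
theorem sum_prod_weight_mul {p : ι → Bool → R} (hp : ∀ j, p j false + p j true = 1) (u : ι)
    (Φ : (ι → Bool) → Bool → R) (hΦ : ∀ ω c a, Φ (Function.update ω u c) a = Φ ω a) :
    ∑ ω, (∏ j, p j (ω j)) * Φ ω (ω u)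
      = ∑ ω, (∏ j, p j (ω j)) * (p u false * Φ ω false + p u true * Φ ω true) := by
  have hinv : Function.Involutive fun x : (ι → Bool) × Bool =>
      (Function.update x.1 u x.2, x.1 u) := by
    rintro ⟨ω, a⟩
    simp
  calc ∑ ω, (∏ j, p j (ω j)) * Φ ω (ω u)
      = ∑ x : (ι → Bool) × Bool, ((∏ j, p j (x.1 j)) * p u x.2) * Φ x.1 (x.1 u) := by
        rw [Fintype.sum_prod_type]
        refine Finset.sum_congr rfl fun ω _ => ?_
        rw [Fintype.sum_bool, ← add_mul, ← mul_add, add_comm (p u true), hp, mul_one]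
    _ = ∑ x : (ι → Bool) × Bool, ((∏ j, p j (x.1 j)) * p u x.2) * Φ x.1 x.2 := by
        rw [← Equiv.sum_comp hinv.toPerm]
        refine Finset.sum_congr rfl fun x _ => ?_
        simp only [Function.Involutive.coe_toPerm, Function.update_self]
        rw [prod_weight_update_mul, hΦ]
    _ = _ := by
        rw [Fintype.sum_prod_type]
        refine Finset.sum_congr rfl fun ω _ => ?_
        rw [Fintype.sum_bool]
        ring

end ProductWeights

/-! ### Second moment bound along the history -/

namespace SeqProtocol

variable {B n : ℕ} (P : SeqProtocol.{u} B n)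

instance isMarkovKernel_step (x : Fin n → Fin B) (i : ℕ) : IsMarkovKernel (P.step x i) := by
  unfold step; infer_instance

instance isProbabilityMeasure_law (x : Fin n → Fin B) :
    ∀ i, IsProbabilityMeasure (P.law x i)
  | 0 => P.probSeed
  | i + 1 => by
    have := isProbabilityMeasure_law x i
    exact inferInstanceAs (IsProbabilityMeasure (P.law x i ⊗ₘ P.step x i))

/-- The product of `c j` over the users `j` queried along a history. -/
noncomputable def histProd (c : Fin n → ℝ≥0∞) : ∀ i, Hist P.Seed P.Msg i → ℝ≥0∞
  | 0, _ => 1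
  | i + 1, h => histProd c i h.1 * c (P.user i h.1)

theorem measurable_histProd (c : Fin n → ℝ≥0∞) : ∀ i, Measurable (P.histProd c i)
  | 0 => measurable_const
  | i + 1 => ((measurable_histProd c i).comp measurable_fst).mul
      (((measurable_of_finite c).comp (P.measurable_user i)).comp measurable_fst)

/-- As no user is queried twice, no factor repeats. With factors at least one, the product over all
users then dominates. -/
theorem histProd_eq_prod (c : Fin n → ℝ≥0∞) :
    ∀ i ≤ n, ∀ h, P.histProd c i h = ∏ j ∈ queried P.user i h, c j
  | 0, _, _ => rfl
  | i + 1, hi, h => by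
    change P.histProd c i h.1 * c (P.user i h.1)
      = ∏ j ∈ insert (P.user i h.1) (queried P.user i h.1), c j
    rw [Finset.prod_insert (P.user_notMem i hi h.1), histProd_eq_prod c i (by omega), mul_comm]

theorem lintegral_law_succ (x : Fin n → Fin B) (i : ℕ) {f : Hist P.Seed P.Msg (i + 1) → ℝ≥0∞}
    (hf : Measurable f) :
    ∫⁻ h, f h ∂P.law x (i + 1)
      = ∫⁻ h, ∫⁻ y, f (h, y) ∂P.mech i (h, x (P.user i h)) ∂P.law x i :=
  Measure.lintegral_compProd (μ := P.law x i) (κ := P.step x i) hf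

theorem measurable_lintegral_mech (x : Fin n → Fin B) (i : ℕ)
    {f : Hist P.Seed P.Msg (i + 1) → ℝ≥0∞} (hf : Measurable f) :
    Measurable fun h => ∫⁻ y, f (h, y) ∂P.mech i (h, x (P.user i h)) :=
  Measurable.lintegral_kernel_prod_right' (κ := P.step x i) hf

variable {P}

/-- Second moment bound: each user `j` independently holds `d j false` or `d j true` with
probabilities `p j false` and `p j true`; the mixture of the laws of the histories is compared with
the law for the dataset `fun j => d j false`. -/
theorem sq_sum_lintegral_law_le {ε : ℝ} (hP : P.IsLDP ε) (d : Fin n → Bool → Fin B)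
    {p : Fin n → Bool → ℝ≥0∞} (hp : ∀ j, p j false + p j true = 1) :
    ∀ i ≤ n, ∀ F : Hist P.Seed P.Msg i → (Fin n → Bool) → ℝ≥0∞,
      (∀ ω, Measurable fun h => F h ω) →
      (∀ h, ∀ j ∈ queried P.user i h, ∀ ω a, F h (Function.update ω j a) = F h ω) →
      (∑ ω, (∏ j, p j (ω j)) * ∫⁻ h, F h ω ∂P.law (fun j => d j (ω j)) i) ^ 2
        ≤ ∫⁻ h, P.histProd
              (fun j => 1 + p j true ^ 2 * ENNReal.ofReal (Real.exp ε + Real.exp (-ε) - 2)) i h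
            * (∑ ω, (∏ j, p j (ω j)) * F h ω) ^ 2 ∂P.law (fun j => d j false) i := by
  intro i
  induction i with
  | zero =>
    intro _ F hF _
    have hm : Measurable fun h => ∑ ω, (∏ j, p j (ω j)) * F h ω :=
      Finset.measurable_sum _ fun ω _ => (hF ω).const_mul _
    have hsum : ∑ ω, (∏ j, p j (ω j)) * ∫⁻ h, F h ω ∂P.law (fun j => d j (ω j)) 0
        -- Before any message the law is that of the seed, whatever the dataset.
        = ∫⁻ h, 1 * (∑ ω, (∏ j, p j (ω j)) * F h ω) ∂P.law (fun j => d j false) 0 := by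
      simp only [one_mul]
      rw [lintegral_finsetSum _ fun ω _ => (hF ω).const_mul _]
      refine Finset.sum_congr rfl fun ω _ => ?_
      rw [lintegral_const_mul _ (hF ω)]
      rfl
    rw [hsum]
    refine (sq_lintegral_mul_le _ measurable_const hm).trans_eq ?_
    simp [histProd]
  | succ i ih =>
    intro hi F hF hFu
    set δ := ENNReal.ofReal (Real.exp ε + Real.exp (-ε) - 2)
    set c : Fin n → ℝ≥0∞ := fun j => 1 + p j true ^ 2 * δ
    have hm : Measurable fun h => ∑ ω, (∏ j, p j (ω j)) * F h ω :=
      Finset.measurable_sum _ fun ω _ => (hF ω).const_mul _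
    have hsection : ∀ (h : Hist P.Seed P.Msg i) (f : Hist P.Seed P.Msg (i + 1) → ℝ≥0∞),
        Measurable f → Measurable fun y => f (h, y) :=
      fun h f hf => hf.comp (measurable_prodMk_left (x := h))
    -- The last message is integrated out. The new integrand depends on the bit of the current user
    -- only through the mechanism.
    have key := ih (by omega)
      (fun h ω => ∫⁻ y, F (h, y) ω ∂P.mech i (h, d (P.user i h) (ω (P.user i h))))
      (fun ω => P.measurable_lintegral_mech (fun j => d j (ω j)) i (hF ω)) ?_
    · calc _ = _ := by
            congr 1
            refine Finset.sum_congr rfl fun ω _ => ?_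
            rw [P.lintegral_law_succ _ i (hF ω)]
        _ ≤ _ := key
        _ ≤ ∫⁻ h, P.histProd c i h * (c (P.user i h)
              * ∫⁻ y, (∑ ω, (∏ j, p j (ω j)) * F (h, y) ω) ^ 2
                  ∂P.mech i (h, d (P.user i h) false)) ∂P.law (fun j => d j false) i := by
            refine lintegral_mono fun h => mul_le_mul_right ?_ _
            rw [sum_prod_weight_mul hp (P.user i h)
              (fun ω a => ∫⁻ y, F (h, y) ω ∂P.mech i (h, d (P.user i h) a))]
            · have hmix := sq_lintegral_mixture_le (ε := ε)
                (fun S hS => hP i hi h (d (P.user i h) true) (d (P.user i h) false) S hS)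
                (fun S hS => hP i hi h (d (P.user i h) false) (d (P.user i h) true) S hS)
                (hp (P.user i h)) (hsection h _ hm)
              refine le_trans (le_of_eq ?_) hmix
              congr 1
              have hswap : ∀ a, ∫⁻ y, ∑ ω, (∏ j, p j (ω j)) * F (h, y) ω
                    ∂P.mech i (h, d (P.user i h) a)
                  = ∑ ω, (∏ j, p j (ω j)) * ∫⁻ y, F (h, y) ω
                    ∂P.mech i (h, d (P.user i h) a) := by
                intro a
                rw [lintegral_finsetSum _ fun ω _ => (hsection h _ (hF ω)).const_mul _]
                refine Finset.sum_congr rfl fun ω _ => ?_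
                rw [lintegral_const_mul _ (hsection h _ (hF ω))]
              rw [hswap, hswap, Finset.mul_sum, Finset.mul_sum, ← Finset.sum_add_distrib]
              refine Finset.sum_congr rfl fun ω _ => ?_
              ring
            · intro ω b a
              refine lintegral_congr fun y => hFu (h, y) _ ?_ ω b
              exact Finset.mem_insert_self _ _
        _ = _ := by
            refine Eq.trans ?_ (P.lintegral_law_succ _ i
              ((P.measurable_histProd c (i + 1)).mul (hm.pow_const 2))).symm
            refine lintegral_congr fun h => ?_
            rw [← mul_assoc, ← lintegral_const_mul _ ((hsection h _ hm).pow_const 2)]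
            rfl
    -- The current user is new, so bits of earlier users still do not matter.
    · intro h j hj ω a
      have hne : P.user i h ≠ j := fun he => P.user_notMem i hi h (he ▸ hj)
      simp only [Function.update_of_ne hne]
      exact lintegral_congr fun y => hFu (h, y) j (Finset.mem_insert_of_mem hj) ω a

/-- Second moment bound for the probability of an event after all rounds. -/
theorem sq_sum_law_le {ε : ℝ} (hP : P.IsLDP ε) (d : Fin n → Bool → Fin B)
    {p : Fin n → Bool → ℝ≥0∞} (hp : ∀ j, p j false + p j true = 1)
    {A : Set (Hist P.Seed P.Msg n)} (hA : MeasurableSet A) :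
    (∑ ω : Fin n → Bool, (∏ j, p j (ω j)) * P.law (fun j => d j (ω j)) n A) ^ 2
      ≤ (∏ j, (1 + p j true ^ 2 * ENNReal.ofReal (Real.exp ε + Real.exp (-ε) - 2)))
          * P.law (fun j => d j false) n A := by
  have h := sq_sum_lintegral_law_le hP d hp n le_rfl (fun h _ => A.indicator 1 h)
    (fun _ => measurable_one.indicator hA) (fun _ _ _ _ _ => rfl)
  simp only [lintegral_indicator_one hA, ← Finset.sum_mul, sum_prod_weight hp, one_mul] at h
  refine h.trans ?_
  rw [← lintegral_indicator_one hA, ← lintegral_const_mul _ (measurable_one.indicator hA)]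
  refine lintegral_mono fun x => ?_
  refine mul_le_mul' ?_ ?_
  · rw [P.histProd_eq_prod _ n le_rfl]
    exact Finset.prod_le_prod_of_subset_of_one_le' (Finset.subset_univ _) fun _ _ _ => le_self_add
  · by_cases hx : x ∈ A <;> simp [hx]

end SeqProtocol

/-! ### From the second moment to disjoint events -/

/-- The weight that a Bernoulli variable with mean `β j` gives to a bit. -/
def bitWeight {ι : Type*} (β : ι → ℝ) (j : ι) (a : Bool) : ℝ := if a then β j else 1 - β j

theorem bitWeight_nonneg {ι : Type*} {β : ι → ℝ} (h0 : ∀ j, 0 ≤ β j) (h1 : ∀ j, β j ≤ 1) (j : ι)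
    (a : Bool) : 0 ≤ bitWeight β j a := by
  cases a <;> simp [bitWeight, h0, h1]

theorem prod_bitWeight_nonneg {ι : Type*} [Fintype ι] {β : ι → ℝ} (h0 : ∀ j, 0 ≤ β j)
    (h1 : ∀ j, β j ≤ 1) (ω : ι → Bool) : 0 ≤ ∏ j, bitWeight β j (ω j) :=
  Finset.prod_nonneg fun j _ => bitWeight_nonneg h0 h1 j (ω j)

/-- The linear Taylor terms at `ε` and `-ε` cancel, and each remainder is at most `ε ^ 2`. -/
theorem exp_add_exp_neg_sub_two_le {ε : ℝ} (h0 : 0 ≤ ε) (h1 : ε ≤ 1) :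
    Real.exp ε + Real.exp (-ε) - 2 ≤ 2 * ε ^ 2 := by
  have ha := Real.abs_exp_sub_one_sub_id_le (x := ε) (by rw [abs_of_nonneg h0]; exact h1)
  have hb := Real.abs_exp_sub_one_sub_id_le (x := -ε) (by rw [abs_neg, abs_of_nonneg h0]; exact h1)
  have ha' := (abs_le.1 ha).2
  have hb' := (abs_le.1 hb).2
  nlinarith

/-- If `B` disjoint events, the `v`-th of which has probability at least `s` when each user `j`
independently holds `v` with probability `β j` and `b j` otherwise, are determined by the history
of an `ε`-LDP protocol, then `∑ j, β j ^ 2` is large. -/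
theorem SeqProtocol.IsLDP.card_mul_sq_le {B n : ℕ} {P : SeqProtocol.{u} B n} {ε : ℝ}
    (hP : P.IsLDP ε) (hε0 : 0 ≤ ε) (hε1 : ε ≤ 1) (b : Fin n → Fin B) {β : Fin n → ℝ}
    (h0 : ∀ j, 0 ≤ β j) (h1 : ∀ j, β j ≤ 1) {A : Fin B → Set (Hist P.Seed P.Msg n)}
    (hA : ∀ v, MeasurableSet (A v)) (hdisj : Pairwise fun v w => Disjoint (A v) (A w)) {s : ℝ}
    (hs0 : 0 ≤ s)
    (hs : ∀ v, s ≤ ∑ ω : Fin n → Bool, (∏ j, bitWeight β j (ω j))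
      * (P.law (fun j => if ω j then v else b j) n).real (A v)) :
    B * s ^ 2 ≤ Real.exp (2 * ε ^ 2 * ∑ j, β j ^ 2) := by
  set δ := Real.exp ε + Real.exp (-ε) - 2 with hδ
  set p : Fin n → Bool → ℝ≥0∞ := fun j a => ENNReal.ofReal (bitWeight β j a) with hpdef
  have hp : ∀ j, p j false + p j true = 1 := fun j => by
    rw [hpdef]
    simp only
    rw [← ENNReal.ofReal_add (bitWeight_nonneg h0 h1 _ _) (bitWeight_nonneg h0 h1 _ _)]
    simp [bitWeight]
  have hprod : ∏ j, (1 + p j true ^ 2 * ENNReal.ofReal δ)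
      ≤ ENNReal.ofReal (Real.exp (2 * ε ^ 2 * ∑ j, β j ^ 2)) := by
    rw [Finset.mul_sum, Real.exp_sum, ENNReal.ofReal_prod_of_nonneg fun j _ => (Real.exp_pos _).le]
    refine Finset.prod_le_prod' fun j _ => ?_
    calc 1 + p j true ^ 2 * ENNReal.ofReal δ
        ≤ 1 + ENNReal.ofReal (β j ^ 2) * ENNReal.ofReal (2 * ε ^ 2) := by
          gcongr
          · simp [hpdef, bitWeight, ENNReal.ofReal_pow (h0 j)]
          · exact exp_add_exp_neg_sub_two_le hε0 hε1
      _ = ENNReal.ofReal (2 * ε ^ 2 * β j ^ 2 + 1) := by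
          rw [ENNReal.ofReal_add (by positivity) zero_le_one, ENNReal.ofReal_one, add_comm,
            ← ENNReal.ofReal_mul (by positivity), mul_comm]
      _ ≤ _ := ENNReal.ofReal_le_ofReal (Real.add_one_le_exp _)
  have hv : ∀ v, ENNReal.ofReal s ^ 2
      ≤ ENNReal.ofReal (Real.exp (2 * ε ^ 2 * ∑ j, β j ^ 2)) * P.law b n (A v) := by
    intro v
    have hmain := SeqProtocol.sq_sum_law_le hP (fun j a => if a then v else b j) hp (hA v)
    simp only [Bool.false_eq_true, if_false] at hmain
    refine le_trans (pow_le_pow_left' ?_ 2) (hmain.trans (mul_le_mul_left hprod _))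
    refine (ENNReal.ofReal_le_ofReal (hs v)).trans_eq ?_
    rw [ENNReal.ofReal_sum_of_nonneg fun ω _ =>
      mul_nonneg (prod_bitWeight_nonneg h0 h1 ω) measureReal_nonneg]
    refine Finset.sum_congr rfl fun ω _ => ?_
    rw [ENNReal.ofReal_mul (prod_bitWeight_nonneg h0 h1 ω),
      ENNReal.ofReal_prod_of_nonneg fun j _ => bitWeight_nonneg h0 h1 j (ω j),
      ofReal_measureReal]
  have hsum : ∑ v, P.law b n (A v) ≤ 1 := by
    rw [← measure_biUnion_finset (fun v _ w _ hvw => hdisj hvw) fun v _ => hA v]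
    exact prob_le_one
  have htot : ENNReal.ofReal (B * s ^ 2)
      ≤ ENNReal.ofReal (Real.exp (2 * ε ^ 2 * ∑ j, β j ^ 2)) := by
    calc ENNReal.ofReal (B * s ^ 2) = ∑ _v : Fin B, ENNReal.ofReal s ^ 2 := by
          rw [ENNReal.ofReal_mul (by positivity), ENNReal.ofReal_pow hs0]
          simp
      _ ≤ ∑ v, ENNReal.ofReal (Real.exp (2 * ε ^ 2 * ∑ j, β j ^ 2)) * P.law b n (A v) :=
          Finset.sum_le_sum fun v _ => hv v
      _ = ENNReal.ofReal (Real.exp (2 * ε ^ 2 * ∑ j, β j ^ 2)) * ∑ v, P.law b n (A v) :=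
          (Finset.mul_sum _ _ _).symm
      _ ≤ _ := mul_le_of_le_one_right' hsum
  exact (ENNReal.ofReal_le_ofReal_iff (Real.exp_pos _).le).1 htot

/-! ### The hard distribution for quantiles -/

/-- If at most `n (q - α)` data points lie below `v` and at most `n (1 - q - α)` lie above it, then
the only approximate quantile is the left endpoint of the jump at `v`. -/
theorem IsApproxQuantile.eq_of_card_le {B n : ℕ} (hn : 1 ≤ n) {q α : ℝ} {x : Fin n → Fin B}
    {v : Fin B} {m : ℕ}
    (hlt : ((Finset.univ.filter fun j => x j < v).card : ℝ) ≤ n * (q - α))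
    (hgt : ((Finset.univ.filter fun j => v < x j).card : ℝ) ≤ n * (1 - q - α))
    (h : IsApproxQuantile q α x m) : m = v := by
  obtain ⟨t, ⟨ht1, ht2⟩, ht3, ht4⟩ := h
  have hn' : (0 : ℝ) < n := by exact_mod_cast hn
  rcases lt_trichotomy m (v : ℕ) with hm | hm | hm
  · exfalso
    have hle : ecdf x (m + 1) ≤ q - α := by
      unfold ecdf
      rw [div_le_iff₀ hn', mul_comm]
      refine le_trans ?_ hlt
      exact_mod_cast Finset.card_le_card fun j => by
        simp only [Finset.mem_filter, Finset.mem_univ, true_and, Fin.lt_def]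
        omega
    linarith
  · exact hm
  · exfalso
    have hle : q + α ≤ ecdf x m := by
      unfold ecdf
      rw [le_div_iff₀ hn']
      have hcard := Finset.card_filter_add_card_filter_not (s := (Finset.univ : Finset (Fin n)))
        (fun j => (x j : ℕ) + 1 ≤ m)
      have hsub : (Finset.univ.filter fun j => ¬ (x j : ℕ) + 1 ≤ m).card
          ≤ (Finset.univ.filter fun j => v < x j).card :=
        Finset.card_le_card fun j => by
          simp only [Finset.mem_filter, Finset.mem_univ, true_and, Fin.lt_def]
          omega
      rw [Finset.card_univ, Fintype.card_fin] at hcard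
      have hcard' : ((Finset.univ.filter fun j => (x j : ℕ) + 1 ≤ m).card : ℝ)
          + (Finset.univ.filter fun j => ¬ (x j : ℕ) + 1 ≤ m).card = n := by exact_mod_cast hcard
      have hsub' : ((Finset.univ.filter fun j => ¬ (x j : ℕ) + 1 ≤ m).card : ℝ)
          ≤ (Finset.univ.filter fun j => v < x j).card := by exact_mod_cast hsub
      nlinarith
    linarith

/-- Lower tail of a sum of independent bits, by the exponential moment method. -/
theorem sum_bitWeight_lower_tail {ι : Type*} [Fintype ι] [DecidableEq ι] {β : ι → ℝ}
    (h0 : ∀ j, 0 ≤ β j) (h1 : ∀ j, β j ≤ 1) (S : Finset ι) (t : ℝ) :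
    ∑ ω : ι → Bool with ((S.filter fun j => ω j).card : ℝ) ≤ t, ∏ j, bitWeight β j (ω j)
      ≤ Real.exp (t - (∑ j ∈ S, β j) / 2) := by
  set e : ι → Bool → ℝ := fun j a => if j ∈ S ∧ a then Real.exp (-1) else 1 with he
  have he0 : ∀ j a, 0 ≤ e j a := fun j a => by
    simp only [he]; split_ifs <;> positivity
  -- So a bit in `S` contributes at most `1 - β j / 2 ≤ exp (-β j / 2)` to the moment.
  have hexp : Real.exp (-1) ≤ 1 / 2 := by
    rw [Real.exp_neg, inv_le_comm₀ (Real.exp_pos _) (by norm_num)]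
    have := Real.add_one_le_exp (1 : ℝ)
    norm_num at this ⊢
    exact this
  have hmoment : ∑ ω : ι → Bool, ∏ j, (bitWeight β j (ω j) * e j (ω j))
      ≤ Real.exp (-(∑ j ∈ S, β j) / 2) := by
    rw [← Fintype.piFinset_univ,
      ← Finset.prod_univ_sum (fun _ => Finset.univ) fun j a => bitWeight β j a * e j a]
    have : -(∑ j ∈ S, β j) / 2 = ∑ j, if j ∈ S then -β j / 2 else 0 := by
      rw [Finset.sum_ite_mem, Finset.univ_inter, ← Finset.sum_div, Finset.sum_neg_distrib]
    rw [this, Real.exp_sum]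
    refine Finset.prod_le_prod (fun j _ => Finset.sum_nonneg fun a _ =>
      mul_nonneg (bitWeight_nonneg h0 h1 j a) (he0 j a)) fun j _ => ?_
    rw [Fintype.sum_bool]
    by_cases hj : j ∈ S
    · have := Real.add_one_le_exp (-β j / 2)
      simp only [bitWeight, he, hj, true_and, if_true, Bool.false_eq_true, if_false]
      nlinarith [h0 j]
    · simp [bitWeight, he, hj]
  have hterm : ∀ ω : ι → Bool, ∏ j, e j (ω j)
      = Real.exp (-((S.filter fun j => ω j).card : ℝ)) := by
    intro ω
    have : -((S.filter fun j => ω j).card : ℝ) = ∑ j, if j ∈ S ∧ ω j then (-1 : ℝ) else 0 := by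
      rw [← Finset.sum_filter, Finset.sum_const, ← Finset.filter_filter]
      simp
    rw [this, Real.exp_sum]
    refine Finset.prod_congr rfl fun j _ => ?_
    simp only [he]
    split_ifs <;> simp
  calc ∑ ω : ι → Bool with ((S.filter fun j => ω j).card : ℝ) ≤ t, ∏ j, bitWeight β j (ω j)
      ≤ ∑ ω : ι → Bool with ((S.filter fun j => ω j).card : ℝ) ≤ t,
          Real.exp t * ∏ j, (bitWeight β j (ω j) * e j (ω j)) := by
        refine Finset.sum_le_sum fun ω hω => ?_
        rw [Finset.prod_mul_distrib, hterm, mul_left_comm, ← Real.exp_add]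
        refine le_mul_of_one_le_right (prod_bitWeight_nonneg h0 h1 ω) (Real.one_le_exp ?_)
        have := (Finset.mem_filter.1 hω).2
        linarith
    _ ≤ ∑ ω : ι → Bool, Real.exp t * ∏ j, (bitWeight β j (ω j) * e j (ω j)) := by
        refine Finset.sum_le_sum_of_subset_of_nonneg (Finset.filter_subset _ _) fun ω _ _ => ?_
        exact mul_nonneg (Real.exp_pos _).le (Finset.prod_nonneg fun j _ =>
          mul_nonneg (bitWeight_nonneg h0 h1 j _) (he0 j _))
    _ ≤ Real.exp t * Real.exp (-(∑ j ∈ S, β j) / 2) := by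
        rw [← Finset.mul_sum]
        gcongr
    _ = _ := by
        rw [← Real.exp_add]
        congr 1
        ring

/-- Bits that are deterministically `1` on `T` and `0` elsewhere. -/
theorem one_le_sum_bitWeight_indicator {ι : Type*} [Fintype ι] [DecidableEq ι] (S T : Finset ι)
    {t : ℝ} (ht : ((S \ T).card : ℝ) ≤ t) :
    1 ≤ ∑ ω : ι → Bool with ((S.filter fun j => ¬ ω j).card : ℝ) ≤ t,
      ∏ j, bitWeight (fun j => if j ∈ T then 1 else 0) j (ω j) := by
  have hmem : (fun j => decide (j ∈ T)) ∈ Finset.univ.filter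
      fun ω : ι → Bool => ((S.filter fun j => ¬ ω j).card : ℝ) ≤ t := by
    rw [Finset.mem_filter]
    refine ⟨Finset.mem_univ _, ?_⟩
    rw [← Finset.filter_notMem_eq_sdiff] at ht
    simpa using ht
  refine le_trans (le_of_eq ?_) (Finset.single_le_sum (fun ω _ => prod_bitWeight_nonneg
    (fun j => by split_ifs <;> norm_num) (fun j => by split_ifs <;> norm_num) ω) hmem)
  refine (Finset.prod_eq_one fun j _ => ?_).symm
  by_cases hj : j ∈ T <;> simp [bitWeight, hj]

/-- The hard distribution: the users outside `S` hold a fixed value, and each user `j` in `S`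
switches to the hidden value independently with probability `β j`. -/
theorem exists_switching_probabilities {n : ℕ} (hn : 1 ≤ n) {α θ θ' : ℝ} (hα : 0 < α)
    (hsum : θ + θ' = 1 - 2 * α) (hθ : 0 ≤ θ) (hθ' : 0 ≤ θ') (hhalf : θ' ≤ 1 / 2) :
    ∃ (S : Finset (Fin n)) (β : Fin n → ℝ), (∀ j, 0 ≤ β j) ∧ (∀ j, β j ≤ 1) ∧
      (Sᶜ.card : ℝ) ≤ n * θ' ∧
      19 / 20 ≤ ∑ ω : Fin n → Bool with ((S.filter fun j => ¬ ω j).card : ℝ) ≤ n * θ,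
        ∏ j, bitWeight β j (ω j) ∧
      (∑ j, β j ^ 2 ≤ 3 ∨ ∑ j, β j ^ 2 ≤ 1024 * α ^ 2 * n) := by
  have hn' : (1 : ℝ) ≤ n := by exact_mod_cast hn
  obtain ⟨K, -, hK⟩ := Finset.exists_subset_card_eq
    (s := (Finset.univ : Finset (Fin n))) (n := ⌊n * θ'⌋₊) (by
      rw [Finset.card_univ, Fintype.card_fin]
      exact Nat.floor_le_of_le (by nlinarith))
  have hfl : (⌊n * θ'⌋₊ : ℝ) ≤ n * θ' := Nat.floor_le (by positivity)
  have hfl' : n * θ' < ⌊n * θ'⌋₊ + 1 := Nat.lt_floor_add_one _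
  obtain ⟨S, hS⟩ : ∃ S, S = Kᶜ := ⟨_, rfl⟩
  have hSc : (Sᶜ.card : ℝ) ≤ n * θ' := by rw [hS, compl_compl, hK]; exact hfl
  have hScard : (S.card : ℝ) = n - ⌊n * θ'⌋₊ := by
    have h := Finset.card_add_card_compl K
    rw [hK, ← hS, Fintype.card_fin] at h
    have h' : (⌊n * θ'⌋₊ : ℝ) + S.card = n := by exact_mod_cast h
    linarith
  have hSlow : (n : ℝ) / 2 ≤ S.card := by nlinarith
  -- Hence `2 α n + 1` switches leave at most `n θ` unswitched users in `S`. The `1` is from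
  -- rounding.
  have hSup : (S.card : ℝ) ≤ n * θ + (2 * (α * n) + 1) := by
    have : θ' = 1 - 2 * α - θ := by linarith
    subst this
    nlinarith
  have hsq : ∀ T : Finset (Fin n), ∑ j, (if j ∈ T then (1 : ℝ) else 0) ^ 2 = T.card := by
    intro T
    simp [ite_pow]
  have hind0 : ∀ (T : Finset (Fin n)) (j : Fin n), (0 : ℝ) ≤ if j ∈ T then 1 else 0 :=
    fun T j => by split_ifs <;> norm_num
  have hind1 : ∀ (T : Finset (Fin n)) (j : Fin n), (if j ∈ T then (1 : ℝ) else 0) ≤ 1 :=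
    fun T j => by split_ifs <;> norm_num
  have hnθ : 0 ≤ n * θ := by positivity
  -- Here `2 α n + 1 < 3`, so three deterministic switches suffice.
  by_cases hsmall : α * n < 1
  · obtain ⟨T, hTS, hT⟩ := Finset.exists_subset_card_eq (min_le_right 3 S.card)
    refine ⟨S, fun j => if j ∈ T then 1 else 0, hind0 T, hind1 T, hSc, ?_, Or.inl ?_⟩
    · refine le_trans (by norm_num) (one_le_sum_bitWeight_indicator S T ?_)
      rw [Finset.card_sdiff_of_subset hTS, Nat.cast_sub (Finset.card_le_card hTS), hT]
      rcases le_total 3 S.card with h | h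
      · rw [min_eq_left h]; push_cast; linarith
      · rw [min_eq_right h]; linarith
    · rw [hsq, hT]
      exact_mod_cast min_le_left _ _
  -- For such `α` all of `S` may switch, since `n ≤ 1024 α² n`.
  · by_cases hbig : 1 / 32 ≤ α
    · refine ⟨S, fun j => if j ∈ S then 1 else 0, hind0 S, hind1 S, hSc, ?_, Or.inr ?_⟩
      · refine le_trans (by norm_num) (one_le_sum_bitWeight_indicator S S ?_)
        simpa using hnθ
      · rw [hsq]
        have h1 : (S.card : ℝ) ≤ n := by
          rw [hScard]; linarith [Nat.cast_nonneg (α := ℝ) ⌊n * θ'⌋₊]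
        have h2 : 1 ≤ 1024 * α ^ 2 := by nlinarith
        nlinarith
    · push Not at hsmall hbig
      -- The mean number of switches is at least `16 α n`, while `3 α n` suffice as `α n ≥ 1`. The
      -- tail is at most `exp (3 α n - 8 α n) ≤ exp (-5)`.
      set β : Fin n → ℝ := fun j => if j ∈ S then 32 * α else 0 with hβ
      have h0 : ∀ j, 0 ≤ β j := fun j => by simp only [hβ]; split_ifs <;> positivity
      have h1 : ∀ j, β j ≤ 1 := fun j => by simp only [hβ]; split_ifs <;> linarith
      refine ⟨S, β, h0, h1, hSc, ?_, Or.inr ?_⟩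
      · have htail := sum_bitWeight_lower_tail h0 h1 S (3 * (α * n))
        have htot := sum_prod_weight (p := bitWeight β) fun j => by simp [bitWeight]
        have hβS : ∑ j ∈ S, β j = S.card * (32 * α) := by
          rw [Finset.sum_congr rfl (g := fun _ => 32 * α) fun j hj => by simp [hβ, hj]]
          simp
        have hexp : Real.exp (3 * (α * n) - (∑ j ∈ S, β j) / 2) ≤ 1 / 20 := by
          calc Real.exp (3 * (α * n) - (∑ j ∈ S, β j) / 2) ≤ Real.exp (-5) := by
                rw [Real.exp_le_exp, hβS]
                nlinarith
            _ ≤ 1 / 20 := by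
                have h2 : (2 : ℝ) ≤ Real.exp 1 := by
                  have := Real.add_one_le_exp (1 : ℝ); linarith
                have h5 : Real.exp 5 = Real.exp 1 ^ 5 := by rw [← Real.exp_nat_mul]; norm_num
                have h32 : (2 : ℝ) ^ 5 ≤ Real.exp 5 := by rw [h5]; gcongr
                rw [Real.exp_neg, inv_le_comm₀ (Real.exp_pos _) (by norm_num)]
                norm_num at h32 ⊢
                linarith
        rw [← Finset.sum_filter_add_sum_filter_not Finset.univ
          (fun ω : Fin n → Bool => ((S.filter fun j => ω j).card : ℝ) ≤ 3 * (α * n))] at htot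
        have hsub : ∑ ω : Fin n → Bool with ¬ ((S.filter fun j => ω j).card : ℝ) ≤ 3 * (α * n),
              ∏ j, bitWeight β j (ω j)
            ≤ ∑ ω : Fin n → Bool with ((S.filter fun j => ¬ ω j).card : ℝ) ≤ n * θ,
              ∏ j, bitWeight β j (ω j) := by
          refine Finset.sum_le_sum_of_subset_of_nonneg (fun ω hω => ?_)
            fun ω _ _ => prod_bitWeight_nonneg h0 h1 ω
          rw [Finset.mem_filter] at hω ⊢
          refine ⟨Finset.mem_univ _, ?_⟩
          have h := Finset.card_filter_add_card_filter_not (s := S) (fun j => ω j = true)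
          have h' : ((S.filter fun j => ω j).card : ℝ) + (S.filter fun j => ¬ ω j).card
              = S.card := by exact_mod_cast h
          linarith [hω.2]
        linarith
      · have : ∑ j, β j ^ 2 = S.card * (32 * α) ^ 2 := by
          simp [hβ, ite_pow]
        rw [this]
        have h1 : (S.card : ℝ) ≤ n := by
          rw [hScard]; linarith [Nat.cast_nonneg (α := ℝ) ⌊n * θ'⌋₊]
        nlinarith [sq_nonneg α]

/-- The success probability of a quantile protocol on the hard distribution. -/
theorem SeqProtocol.SolvesEmpQuantile.le_sum_law {B n : ℕ} (hn : 1 ≤ n) {P : SeqProtocol.{u} B n}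
    {α q : ℝ} (hsol : P.SolvesEmpQuantile α q (3 / 4)) {b : Fin n → Fin B} {β : Fin n → ℝ}
    (h0 : ∀ j, 0 ≤ β j) (h1 : ∀ j, β j ≤ 1) (v : Fin B) {G : Finset (Fin n → Bool)}
    (hG : 19 / 20 ≤ ∑ ω ∈ G, ∏ j, bitWeight β j (ω j))
    (hlt : ∀ ω ∈ G, ((Finset.univ.filter fun j => ¬ ω j ∧ b j < v).card : ℝ) ≤ n * (q - α))
    (hgt : ∀ ω ∈ G, ((Finset.univ.filter fun j => ¬ ω j ∧ v < b j).card : ℝ)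
      ≤ n * (1 - q - α)) :
    57 / 80 ≤ ∑ ω : Fin n → Bool, (∏ j, bitWeight β j (ω j))
      * (P.law (fun j => if ω j then v else b j) n).real {h | P.estimate h = v.castSucc} := by
  -- `57/80 = (19/20) (3/4)`.
  calc (57 / 80 : ℝ) ≤ ∑ ω ∈ G, (∏ j, bitWeight β j (ω j)) * (3 / 4) := by
        rw [← Finset.sum_mul]; linarith
    _ ≤ ∑ ω ∈ G, (∏ j, bitWeight β j (ω j))
      * (P.law (fun j => if ω j then v else b j) n).real {h | P.estimate h = v.castSucc} := by
        refine Finset.sum_le_sum fun ω hω => mul_le_mul_of_nonneg_left ?_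
          (prod_bitWeight_nonneg h0 h1 ω)
        refine (hsol fun j => if ω j then v else b j).trans
          (measureReal_mono (fun h hh => ?_) (measure_ne_top _ _))
        have hh' : IsApproxQuantile q α (fun j => if ω j then v else b j) (P.estimate h : ℕ) := hh
        refine Fin.ext ((IsApproxQuantile.eq_of_card_le hn ?_ ?_ hh').trans
          (Fin.val_castSucc v).symm)
        · refine le_trans ?_ (hlt ω hω)
          exact_mod_cast Finset.card_le_card fun j => by
            by_cases hj : ω j <;> simp [hj]
        · refine le_trans ?_ (hgt ω hω)
          exact_mod_cast Finset.card_le_card fun j => by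
            by_cases hj : ω j <;> simp [hj]
    _ ≤ _ := Finset.sum_le_sum_of_subset_of_nonneg (Finset.subset_univ _) fun ω _ _ =>
        mul_nonneg (prod_bitWeight_nonneg h0 h1 ω) measureReal_nonneg

/-! ### The lower bound on the number of users -/

/-- From the second moment inequality to a bound on `log B`. -/
theorem log_le_of_card_mul_sq_le {B : ℕ} (hB : 4 ≤ B) {t : ℝ}
    (h : B * (57 / 80 : ℝ) ^ 2 ≤ Real.exp t) : Real.log B ≤ 2 * t := by
  have hB' : (4 : ℝ) ≤ B := by exact_mod_cast hB
  have hsq : (B : ℝ) ≤ Real.exp t ^ 2 := by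
    -- As `(57/80)² > 1/2`, `exp t ≥ B / 2`, and `B² / 4 ≥ B` for `B ≥ 4`.
    nlinarith [Real.exp_pos t]
  have hlog := Real.log_le_log (by linarith) hsq
  rwa [Real.log_pow, Real.log_exp] at hlog

/-- The lower bound, up to the degenerate case of an accuracy below the granularity `1 / n`. -/
theorem SeqProtocol.log_le_of_solvesEmpQuantile {B n : ℕ} (hB : 4 ≤ B) (hn : 1 ≤ n) {α ε q : ℝ}
    (hα : 0 < α) (hε0 : 0 < ε) (hε1 : ε ≤ 1) (hq0 : α ≤ q) (hq1 : q ≤ 1 - α)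
    {P : SeqProtocol.{u} B n} (hP : P.IsLDP ε) (hsol : P.SolvesEmpQuantile α q (3 / 4)) :
    Real.log B ≤ 12 * ε ^ 2 ∨ Real.log B ≤ 4096 * (ε ^ 2 * α ^ 2) * n := by
  have hmeas : ∀ v : Fin B, MeasurableSet {h | P.estimate h = v.castSucc} := fun v =>
    P.measurable_estimate (measurableSet_singleton v.castSucc)
  have hdisj : Pairwise fun v w : Fin B =>
      Disjoint {h | P.estimate h = v.castSucc} {h | P.estimate h = w.castSucc} := by
    intro v w hvw
    refine Set.disjoint_left.2 fun h hv hw => hvw (Fin.castSucc_injective B ?_)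
    exact hv.symm.trans hw
  have hfinish : ∀ (b : Fin n → Fin B) (β : Fin n → ℝ), (∀ j, 0 ≤ β j) → (∀ j, β j ≤ 1) →
      (∀ v, 57 / 80 ≤ ∑ ω : Fin n → Bool, (∏ j, bitWeight β j (ω j))
        * (P.law (fun j => if ω j then v else b j) n).real {h | P.estimate h = v.castSucc}) →
      (∑ j, β j ^ 2 ≤ 3 ∨ ∑ j, β j ^ 2 ≤ 1024 * α ^ 2 * n) →
      Real.log B ≤ 12 * ε ^ 2 ∨ Real.log B ≤ 4096 * (ε ^ 2 * α ^ 2) * n := by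
    intro b β h0 h1 hs hβ
    have hlog := log_le_of_card_mul_sq_le hB
      (hP.card_mul_sq_le hε0.le hε1 b h0 h1 hmeas hdisj (by norm_num) hs)
    rcases hβ with hβ | hβ
    · left; nlinarith [sq_nonneg ε]
    · right; nlinarith [mul_le_mul_of_nonneg_left hβ (sq_nonneg ε)]
  obtain ⟨lo, hlo⟩ : ∃ lo : Fin B, ∀ v, ¬ v < lo :=
    ⟨⟨0, by omega⟩, fun v => by rw [Fin.lt_def]; simp only; omega⟩
  obtain ⟨hi, hhi⟩ : ∃ hi : Fin B, ∀ v, ¬ hi < v :=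
    ⟨⟨B - 1, by omega⟩, fun v => by rw [Fin.lt_def]; have := v.2; simp only; omega⟩
  -- The switching set starts on the side of the quantile with more room, so that it contains at
  -- least half the users.
  rcases le_total q (1 / 2) with hq | hq
  · obtain ⟨S, β, h0, h1, hSc, hG, hβ⟩ := exists_switching_probabilities hn (α := α)
      (θ := 1 - q - α) (θ' := q - α) hα (by ring) (by linarith) (by linarith) (by linarith)
    refine hfinish (fun j => if j ∈ S then hi else lo) β h0 h1
      (fun v => hsol.le_sum_law hn h0 h1 v hG (fun ω _ => le_trans ?_ hSc) fun ω hω =>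
        le_trans ?_ (Finset.mem_filter.1 hω).2) hβ
    · exact_mod_cast Finset.card_le_card fun j => by
        by_cases hj : j ∈ S
        · simp [hj, hhi]
        · simp [hj]
    · exact_mod_cast Finset.card_le_card fun j => by
        by_cases hj : j ∈ S
        · simp +contextual [hj]
        · simp [hj, hlo]
  · obtain ⟨S, β, h0, h1, hSc, hG, hβ⟩ := exists_switching_probabilities hn (α := α)
      (θ := q - α) (θ' := 1 - q - α) hα (by ring) (by linarith) (by linarith) (by linarith)
    refine hfinish (fun j => if j ∈ S then lo else hi) β h0 h1
      (fun v => hsol.le_sum_law hn h0 h1 v hG (fun ω hω =>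
        le_trans ?_ (Finset.mem_filter.1 hω).2) fun ω _ => le_trans ?_ hSc) hβ
    · exact_mod_cast Finset.card_le_card fun j => by
        by_cases hj : j ∈ S
        · simp +contextual [hj]
        · simp [hj, hhi]
    · exact_mod_cast Finset.card_le_card fun j => by
        by_cases hj : j ∈ S
        · simp [hj, hlo]
        · simp [hj]

theorem theorem2 :
    ∃ c : ℝ, 0 < c ∧
      -- large domains: the median, and all quantiles that are not too extreme
      (∃ B₀ : ℕ, ∀ B : ℕ, B₀ ≤ B → ∀ α ε q : ℝ, 0 < α → α ≤ 1 / 2 → 0 < ε → ε < 1 →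
        (q = 1 / 2 ∨ q ∈ Set.Ioo (2 * α) (1 - 2 * α)) →
        ∀ n : ℕ, 1 ≤ n → ∀ P : SeqProtocol.{u} B n, P.IsLDP ε → P.SolvesEmpQuantile α q (3 / 4) →
          c * (Real.log B / (ε ^ 2 * α ^ 2)) ≤ n) ∧
      -- explicit thresholds for the quantiles
      (∀ B : ℕ, 4 ≤ B → ∀ α ε q : ℝ, 0 < α → α < 1 / 2 → 0 < ε →
        ε ≤ min 1 (1 / 64 * √(Real.log B)) → q ∈ Set.Ioo (2 * α) (1 - 2 * α) →
        ∀ n : ℕ, 1 ≤ n → ∀ P : SeqProtocol.{u} B n, P.IsLDP ε → P.SolvesEmpQuantile α q (3 / 4) →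
          c * (Real.log B / (ε ^ 2 * α ^ 2)) ≤ n) := by
  have hrearrange : ∀ {L α ε : ℝ} {n : ℕ}, 0 < α → 0 < ε → L ≤ 4096 * (ε ^ 2 * α ^ 2) * n →
      1 / 4096 * (L / (ε ^ 2 * α ^ 2)) ≤ n := by
    intro L α ε n hα hε h
    rw [← mul_div_assoc, div_le_iff₀ (by positivity)]
    linarith
  -- The threshold `exp 13` excludes the degenerate case `log B ≤ 12 ε²`, as `ε < 1`.
  refine ⟨1 / 4096, by norm_num, ⟨max 4 ⌈Real.exp 13⌉₊, ?_⟩, ?_⟩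
  · intro B hB α ε q hα hα' hε hε' hq n hn P hP hsol
    have hlog : 13 ≤ Real.log B := by
      have h13 : Real.exp 13 ≤ B :=
        (Nat.le_ceil _).trans (by exact_mod_cast (le_max_right _ _).trans hB)
      exact (Real.le_log_iff_exp_le ((Real.exp_pos _).trans_le h13)).2 h13
    have hq' : α ≤ q ∧ q ≤ 1 - α := by
      rcases hq with rfl | ⟨h1, h2⟩ <;> constructor <;> linarith
    rcases SeqProtocol.log_le_of_solvesEmpQuantile ((le_max_left _ _).trans hB) hn hα hε hε'.le
      hq'.1 hq'.2 hP hsol with h | h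
    · nlinarith
    · exact hrearrange hα hε h
  · intro B hB α ε q hα _ hε hε' hq n hn P hP hsol
    have hlog : 0 < Real.log B := Real.log_pos (by exact_mod_cast (by omega : 1 < B))
    -- With this, the degenerate case would give `log B ≤ (12 / 4096) log B`.
    have hsq : ε ^ 2 ≤ 1 / 4096 * Real.log B := by
      have := pow_le_pow_left₀ hε.le (hε'.trans (min_le_right _ _)) 2
      rw [mul_pow, Real.sq_sqrt hlog.le] at this
      linarith
    rcases SeqProtocol.log_le_of_solvesEmpQuantile hB hn hα hε (hε'.trans (min_le_left _ _))
      (by linarith [hq.1]) (by linarith [hq.2]) hP hsol with h | h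
    · linarith
    · exact hrearrange hα hε h
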